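/- For a set $A$ let $\mathcal F(A)$ be the set of finite subsets of $A$, and let $H$ be an abelian group. For $\varphi\colon\mathcal F(A)\to H$ and $\beta\in\mathcal F(A)$ let $D_\beta\varphi(\alpha)=\varphi(\alpha\cup\beta)-\varphi(\alpha)$, $\alpha\in\mathcal F(A\setminus\beta)$. Let $\mathrm{Pol}^0_d(A,H)$ be the set of all $\varphi\colon\mathcal F(A)\to H$ with $\varphi(\emptyset)=0$ such that $D_{\beta_d}\cdots D_{\beta_0}\varphi=0$ for all pairwise disjoint $\beta_0,\dots,\beta_d\in\mathcal F(A)$. A disjoint $s$-subcollection in $A$ is a set $B$ of exactly $s$ pairwise disjoint nonempty finite subsets of $A$; $\mathcal F(B)$ is identified with a subset of $\mathcal F(A)$ via $\gamma\mapsto\bigcup\gamma$, and $\varphi|_{\mathcal F(B)}(\gamma)=\varphi(\bigcup\gamma)$. Write $[x]$ for the integer part (floor) of $x\in\mathbb R$ and $[1,r]=\{1,\dots,r\}$. Theorem. For any nonnegative integers $k$, $d_1,\dots,d_k$ and $s$ there exists $r=r(k,(d_1,\dots,d_k),s)\in\mathbb N$ such that for any $\varphi_i\in\mathrm{Pol}^0_{d_i}([1,r],\mathbb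 R)$, $i=1,\dots,k$, there exists a disjoint $s$-subcollection $B$ in $[1,r]$ such that for every $i\in\{1,\dots,k\}$ there are $\psi_i\in\mathrm{Pol}^0_{d_i}(B,\mathbb Z)$ and $e_i\in\{0,-1,\dots,-d_i\}$ with $$\Bigl[\varphi_i\bigl(\textstyle\bigcup\gamma\bigr)\Bigr]=\psi_i(\gamma)+e_i\qquad\text{for every nonempty }\gamma\subseteq B.$$ (The case $k=1$ is the statement for a single polynomial mapping.) -/

import Mathlib

namespace SetPoly

/-- The `β`-derivative `D_β φ (α) = φ (α ∪ β) - φ α` of a mapping `φ : F(A) → H`, where `F(A)` is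
the set of finite subsets of `A`. It is meant to be evaluated at sets `α` disjoint from `β`. -/
def derivative {A H : Type*} [DecidableEq A] [AddCommGroup H]
    (β : Finset A) (φ : Finset A → H) : Finset A → H :=
  fun α => φ (α ∪ β) - φ α

/-- The iterated derivative `D_{β_n} ⋯ D_{β_0} φ` along a list `[β_0, …, β_n]`. -/
def iterDerivative {A H : Type*} [DecidableEq A] [AddCommGroup H] :
    List (Finset A) → (Finset A → H) → (Finset A → H)
  | [], φ => φ
  | β :: l, φ => iterDerivative l (derivative β φ)

/-- `Pol_d(A, H)`: mappings `φ : F(A) → H` such that `D_{β_d} ⋯ D_{β_0} φ = 0` on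
`F(A \ (β_0 ∪ ⋯ ∪ β_d))` for all pairwise disjoint finite `β_0, …, β_d ⊆ A`. -/
def Pol (d : ℕ) (A H : Type*) [DecidableEq A] [AddCommGroup H] : Set (Finset A → H) :=
  {φ | ∀ l : List (Finset A), l.length = d + 1 → l.Pairwise Disjoint →
    ∀ α : Finset A, (∀ β ∈ l, Disjoint α β) → iterDerivative l φ α = 0}

/-- `Pol⁰_d(A, H)`: polynomial mappings of degree at most `d` vanishing at the empty set. -/
def Pol0 (d : ℕ) (A H : Type*) [DecidableEq A] [AddCommGroup H] : Set (Finset A → H) :=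
  {φ | φ ∈ Pol d A H ∧ φ ∅ = 0}

/-- `B` is a disjoint `s`-subcollection in `A`: a collection of exactly `s` pairwise disjoint
nonempty finite subsets of `A`. -/
def IsDisjointSubcollection {A : Type*} (s : ℕ) (B : Finset (Finset A)) : Prop :=
  B.card = s ∧ (∀ C ∈ B, C.Nonempty) ∧ (B : Set (Finset A)).PairwiseDisjoint id

/-- The restriction of `φ : F(A) → H` to `F(B)`, where `γ ∈ F(B)` is identified with the union
of its members, an element of `F(A)`. -/
def restrict {A H : Type*} [DecidableEq A] (φ : Finset A → H) (B : Finset (Finset A)) :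
    Finset {C // C ∈ B} → H :=
  fun γ => φ (γ.biUnion fun C => C.1)

end SetPoly

namespace SetPoly

section Derivative

variable {A H : Type*} [DecidableEq A] [AddCommGroup H]

/-! Colour a finite set by the cells of width `1 / 2 ^ (d i + 3)` containing the fractional parts of
all `φ i`. The finite unions theorem gives `B` whose nonempty unions share one colour, so on `B`
each fractional part is nearly a constant `L`. With `m` the integer nearest `L`, off `∅` the map is
an integer map `ψ` plus `L - m` plus a tiny error. Applying `d + 1` derivatives kills the map and
the constant; the rest is less than `1` in absolute value, so the integer derivative of `ψ`
vanishes. -/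

theorem iterDerivative_add (l : List (Finset A)) (φ ψ : Finset A → H) :
    iterDerivative l (φ + ψ) = iterDerivative l φ + iterDerivative l ψ := by
  induction l generalizing φ ψ with
  | nil => rfl
  | cons β l ih =>
    have h : derivative β (φ + ψ) = derivative β φ + derivative β ψ := by
      funext α
      simp only [derivative, Pi.add_apply]
      abel
    simp only [iterDerivative, h, ih]

theorem iterDerivative_zero (l : List (Finset A)) :
    iterDerivative l (0 : Finset A → H) = 0 := by
  induction l with
  | nil => rfl
  | cons β l ih =>
    have h : derivative β (0 : Finset A → H) = 0 := by
      funext α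
      simp [derivative]
    simp only [iterDerivative, h, ih]

theorem iterDerivative_eq_zero_of_empty_mem {l : List (Finset A)} (hl : ∅ ∈ l)
    (φ : Finset A → H) : iterDerivative l φ = 0 := by
  induction l generalizing φ with
  | nil => simp at hl
  | cons β l ih =>
    rcases List.mem_cons.1 hl with rfl | hl
    · have h : derivative ∅ φ = 0 := by
        funext α
        simp [derivative]
      simp only [iterDerivative, h, iterDerivative_zero]
    · exact ih hl _

theorem iterDerivative_const {l : List (Finset A)} (hl : l ≠ []) (c : H) :
    iterDerivative l (fun _ => c) = 0 := by
  cases l with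
  | nil => exact absurd rfl hl
  | cons β l =>
    have h : derivative β (fun _ : Finset A => c) = 0 := by
      funext α
      simp [derivative]
    simp only [iterDerivative, h, iterDerivative_zero]

/-- For nonempty `β`, the set `α ∪ β` is never empty, so each derivative only flips the sign. This
tracks the correction at `∅`, where nothing is known about the fractional part. -/
theorem iterDerivative_single_empty {l : List (Finset A)} (hl : ∅ ∉ l) (c : H) :
    iterDerivative l (Pi.single ∅ c) = Pi.single ∅ ((-1 : ℤ) ^ l.length • c) := by
  induction l generalizing c with
  | nil => simp [iterDerivative]
  | cons β l ih =>
    have hβ : β ≠ ∅ := fun h => hl (by simp [h])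
    have h : derivative β (Pi.single ∅ c) = Pi.single ∅ (-c) := by
      funext α
      have hαβ : α ∪ β ≠ ∅ := fun h => hβ (Finset.union_eq_empty.1 h).2
      by_cases hα : α = ∅
      · subst hα
        simp [derivative, hβ]
      · simp [derivative, hα, hβ]
    rw [iterDerivative, h, ih (fun h => hl (List.mem_cons_of_mem _ h)), List.length_cons, pow_succ]
    simp

theorem iterDerivative_intCast (l : List (Finset A)) (ψ : Finset A → ℤ) (α : Finset A) :
    iterDerivative l (fun γ => (ψ γ : ℝ)) α = ((iterDerivative l ψ α : ℤ) : ℝ) := by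
  induction l generalizing ψ with
  | nil => rfl
  | cons β l ih =>
    have h : derivative β (fun γ => (ψ γ : ℝ)) = fun γ => ((derivative β ψ γ : ℤ) : ℝ) := by
      funext γ
      simp [derivative]
    rw [iterDerivative, h, ih, iterDerivative]

theorem abs_iterDerivative_le (l : List (Finset A)) {θ : Finset A → ℝ} {ε : ℝ}
    (hθ : ∀ γ, |θ γ| ≤ ε) (α : Finset A) : |iterDerivative l θ α| ≤ 2 ^ l.length * ε := by
  induction l generalizing θ ε with
  | nil => simpa [iterDerivative] using hθ α
  | cons β l ih =>
    have h : ∀ γ, |derivative β θ γ| ≤ 2 * ε := fun γ => by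
      have := abs_sub (θ (γ ∪ β)) (θ γ)
      simp only [derivative]
      linarith [hθ (γ ∪ β), hθ γ]
    have := ih h
    rw [iterDerivative, List.length_cons, pow_succ, mul_assoc]
    exact this

theorem iterDerivative_restrict (B : Finset (Finset A)) (l : List (Finset {C // C ∈ B}))
    (φ : Finset A → H) (γ : Finset {C // C ∈ B}) :
    iterDerivative l (restrict φ B) γ =
      iterDerivative (l.map fun β => β.biUnion fun C => C.1) φ (γ.biUnion fun C => C.1) := by
  induction l generalizing φ with
  | nil => rfl
  | cons β l ih =>
    have h : derivative β (restrict φ B) =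
        restrict (derivative (β.biUnion fun C => C.1) φ) B := by
      funext α
      simp only [derivative, restrict, Finset.union_biUnion]
    rw [iterDerivative, h, ih, List.map_cons, iterDerivative]

theorem disjoint_biUnion_of_disjoint {B : Finset (Finset A)}
    (hB : (B : Set (Finset A)).PairwiseDisjoint id) {β γ : Finset {C // C ∈ B}}
    (h : Disjoint β γ) :
    Disjoint (β.biUnion fun C => C.1) (γ.biUnion fun C => C.1) := by
  simp only [Finset.disjoint_biUnion_left, Finset.disjoint_biUnion_right]
  intro D hD C hC
  refine hB C.2 D.2 fun hCD => Finset.disjoint_left.1 h hC ?_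
  rwa [Subtype.ext hCD]

theorem restrict_mem_Pol0 {d : ℕ} {φ : Finset A → H} (hφ : φ ∈ Pol0 d A H)
    {B : Finset (Finset A)} (hB : (B : Set (Finset A)).PairwiseDisjoint id) :
    restrict φ B ∈ Pol0 d {C // C ∈ B} H := by
  refine ⟨fun l hl hd γ hγ => ?_, by simpa [restrict] using hφ.2⟩
  rw [iterDerivative_restrict]
  refine hφ.1 _ (by simpa using hl) ?_ _ ?_
  · exact List.pairwise_map.2 (hd.imp fun h => disjoint_biUnion_of_disjoint hB h)
  · intro β hβ
    obtain ⟨β', hβ', rfl⟩ := List.mem_map.1 hβ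
    exact disjoint_biUnion_of_disjoint hB (hγ β' hβ')

end Derivative

/-! ### Integer parts of polynomial mappings with nearly constant fractional part -/

section IntegerPart

variable {A : Type*} [DecidableEq A]

/-- A real polynomial mapping whose fractional parts at all nonempty sets lie in one short interval
has as integer part an integer polynomial mapping of the same degree, up to a constant. -/
theorem exists_floor_eq_of_fract_mem {d : ℕ} {φ : Finset A → ℝ} (hφ : φ ∈ Pol0 d A ℝ) {L : ℝ}
    (hL : ∀ γ : Finset A, γ.Nonempty → |Int.fract (φ γ) - L| ≤ 1 / 2 ^ (d + 3)) (hL0 : 0 ≤ L)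
    (hL1 : L < 1) :
    ∃ ψ ∈ Pol0 d A ℤ, ∃ e : ℤ, -(d : ℤ) ≤ e ∧ e ≤ 0 ∧
      ∀ γ : Finset A, γ.Nonempty → ⌊φ γ⌋ = ψ γ + e := by
  -- Degree `0` forces `e = 0`, whereas the general choice `e = -m` may be `-1`.
  rcases Nat.eq_zero_or_pos d with rfl | hd
  · have h0 : ∀ γ, φ γ = 0 := fun γ => by
      have := hφ.1 [γ] rfl (List.pairwise_singleton _ _) ∅ (by simp)
      simpa [iterDerivative, derivative, hφ.2] using this
    refine ⟨0, ⟨fun l _ _ α _ => ?_, rfl⟩, 0, by simp, le_rfl, fun γ _ => by simp [h0]⟩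
    rw [iterDerivative_zero]
    rfl
  set m : ℤ := round L with hm
  have hm0 : 0 ≤ m := by
    rw [hm, round_eq]
    exact Int.floor_nonneg.2 (by linarith)
  have hm1 : m ≤ 1 := by
    have : m < 2 := by
      rw [hm, round_eq]
      exact Int.floor_lt.2 (by push_cast; linarith)
    omega
  set ψ : Finset A → ℤ := fun γ => if γ = ∅ then 0 else ⌊φ γ⌋ + m with hψ
  refine ⟨ψ, ⟨fun l hl hdis α hα => ?_, by simp [hψ]⟩, -m, by omega, by omega, fun γ hγ => ?_⟩
  swap
  · simp [hψ, hγ.ne_empty]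
  by_cases hemp : ∅ ∈ l
  · rw [iterDerivative_eq_zero_of_empty_mem hemp]
    rfl
  set θ : Finset A → ℝ := fun γ => if γ = ∅ then 0 else Int.fract (φ γ) - L with hθ
  have hθle : ∀ γ, |θ γ| ≤ 1 / 2 ^ (d + 3) := fun γ => by
    by_cases hγ : γ = ∅
    · simp [hθ, hγ]
    · simpa [hθ, hγ] using hL γ (Finset.nonempty_iff_ne_empty.2 hγ)
  have hdec : φ = (fun γ => (ψ γ : ℝ)) + ((fun _ => L - m) + (Pi.single ∅ (m - L) + θ)) := by
    funext γ
    by_cases hγ : γ = ∅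
    · subst hγ
      simp [hψ, hθ, hφ.2]
    · simp only [hψ, hθ, Pi.add_apply, hγ, if_false, Pi.single_eq_of_ne hγ, Int.fract]
      push_cast
      ring
  have hne : l ≠ [] := fun h => by simp [h] at hl
  have hsmall : ∀ γ, |iterDerivative l θ γ| ≤ 1 / 4 := fun γ => by
    refine (abs_iterDerivative_le l hθle γ).trans_eq ?_
    rw [hl, pow_add, pow_add]
    field_simp
    norm_num
  have key : ∀ γ, (∀ β ∈ l, Disjoint γ β) → ((iterDerivative l ψ γ : ℤ) : ℝ) +
      ((Pi.single ∅ ((-1 : ℤ) ^ l.length • (m - L)) : Finset A → ℝ) γ + iterDerivative l θ γ) = 0 :=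
    fun γ hγ => by
      have h := hφ.1 l hl hdis γ hγ
      rw [hdec, iterDerivative_add, iterDerivative_add, iterDerivative_add, iterDerivative_const hne,
        iterDerivative_single_empty hemp] at h
      simpa [iterDerivative_intCast] using h
  -- At `∅` the identity puts `L` within `1 / 4` of some integer, hence of its nearest integer `m`.
  have hround : |L - m| ≤ 1 / 4 := by
    have h := key ∅ (by simp)
    rw [Pi.single_eq_same] at h
    have hs := hsmall ∅
    rcases neg_one_pow_eq_or ℤ l.length with h1 | h1 <;> rw [h1] at h
    · refine (round_le L (m + iterDerivative l ψ ∅)).trans ?_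
      have : L - ((m + iterDerivative l ψ ∅ : ℤ) : ℝ) = iterDerivative l θ ∅ := by
        push_cast
        simp at h
        linarith
      rwa [this]
    · refine (round_le L (m - iterDerivative l ψ ∅)).trans ?_
      have : L - ((m - iterDerivative l ψ ∅ : ℤ) : ℝ) = - iterDerivative l θ ∅ := by
        push_cast
        simp at h
        linarith
      rwa [this, abs_neg]
  have hsingle : |(Pi.single ∅ ((-1 : ℤ) ^ l.length • (m - L)) : Finset A → ℝ) α| ≤ 1 / 4 := by
    by_cases h : α = ∅
    · subst h
      rw [Pi.single_eq_same]
      rw [abs_sub_comm] at hround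
      rcases neg_one_pow_eq_or ℤ l.length with h1 | h1 <;> rw [h1]
      · simpa using hround
      · rw [neg_smul, one_smul, abs_neg]
        exact hround
    · simp [h]
  have h := key α hα
  have hs := hsmall α
  rw [abs_le] at hs hsingle
  have hlt : |((iterDerivative l ψ α : ℤ) : ℝ)| < 1 := abs_lt.2 ⟨by linarith, by linarith⟩
  exact Int.abs_lt_one_iff.1 (by exact_mod_cast hlt)

end IntegerPart

/-! ### Finite unions theorem from Hales–Jewett -/

section FiniteUnions

open Combinatorics in
/-- There are arbitrarily many disjoint sets such that the colour of a union of some of them depends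
only on the first set of the union. -/
theorem exists_disjoint_color_eq_of_min (κ : Type) [Finite κ] (m : ℕ) :
    ∃ r : ℕ, ∀ χ : Finset (Fin r) → κ, ∃ (B : Fin m → Finset (Fin r)) (c : Fin m → κ),
      (∀ i, (B i).Nonempty) ∧ Pairwise (fun i j => Disjoint (B i) (B j)) ∧
      ∀ (γ : Finset (Fin m)) (i : Fin m), i ∈ γ → (∀ j ∈ γ, i ≤ j) → χ (γ.biUnion B) = c i := by
  induction m with
  | zero => exact ⟨0, fun χ => ⟨Fin.elim0, Fin.elim0, fun i => i.elim0, fun i => i.elim0,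
      fun _ i => i.elim0⟩⟩
  | succ m ih =>
    obtain ⟨r, hr⟩ := ih
    obtain ⟨n, hn⟩ := Subspace.exists_mono_in_high_dimension_fin Bool κ (Fin r)
    refine ⟨n + 1, fun χ => ?_⟩
    -- The extra coordinate, always `true`, keeps `A₀` nonempty.
    let S : (Fin n → Bool) → Finset (Fin (n + 1)) := fun x =>
      Finset.univ.filter fun j => (Fin.cons true x : Fin (n + 1) → Bool) j = true
    obtain ⟨l, c, hl⟩ := hn fun x => χ (S x)
    let A₀ : Finset (Fin (n + 1)) := S (l fun _ => false)
    let E : Fin r → Finset (Fin (n + 1)) := fun e =>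
      (Finset.univ.filter fun j => l.idxFun j = Sum.inr e).map (Fin.succEmb n)
    have hE : ∀ e, (E e).Nonempty := fun e => by
      obtain ⟨i, hi⟩ := l.proper e
      exact ⟨i.succ, by simp [E, hi]⟩
    have hEd : ∀ e f, e ≠ f → Disjoint (E e) (E f) := fun e f hef => by
      rw [Finset.disjoint_left]
      simp only [E, Finset.mem_map, Finset.mem_filter, Finset.mem_univ, true_and]
      rintro _ ⟨a, ha, rfl⟩ ⟨b, hb, hab⟩
      have : b = a := (Fin.succEmb n).injective hab
      subst this
      exact hef (Sum.inr_injective (ha.symm.trans hb))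
    have hA₀E : ∀ e, Disjoint A₀ (E e) := fun e => by
      rw [Finset.disjoint_left]
      simp only [E, Finset.mem_map, Finset.mem_filter, Finset.mem_univ, true_and]
      rintro _ h ⟨a, ha, rfl⟩
      simp [A₀, S, Subspace.apply_inr ha] at h
    -- Points of the monochromatic subspace are `A₀` together with any of the wildcard blocks `E e`;
    -- the induction then takes place among unions of these blocks.
    have hcol : ∀ δ : Finset (Fin r), χ (A₀ ∪ δ.biUnion E) = c := fun δ => by
      rw [← hl fun e => decide (e ∈ δ)]
      congr 1
      ext j
      refine Fin.cases ?_ (fun a => ?_) j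
      · simp [A₀, S]
      · rcases h : l.idxFun a with b | e
        · simp [A₀, S, E, Subspace.apply_inl h, h]
        · simp [A₀, S, E, Subspace.apply_inr h, h]
    obtain ⟨B, cB, hB, hBd, hBc⟩ := hr fun δ => χ (δ.biUnion E)
    refine ⟨Fin.cons A₀ fun i => (B i).biUnion E, Fin.cons c cB, ?_, ?_, ?_⟩
    · refine Fin.cases ⟨0, by simp [A₀, S]⟩ fun i => ?_
      obtain ⟨e, he⟩ := hB i
      obtain ⟨a, ha⟩ := hE e
      exact ⟨a, by simpa using ⟨e, he, ha⟩⟩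
    · have hdis : ∀ i, Disjoint A₀ ((B i).biUnion E) := fun i =>
        (Finset.disjoint_biUnion_right _ _ _).2 fun e _ => hA₀E e
      intro i j
      refine Fin.cases (Fin.cases (fun h => absurd rfl h) (fun j _ => ?_) j)
        (fun i => Fin.cases (fun _ => ?_) (fun j hij => ?_) j) i
      · simpa only [Fin.cons_zero, Fin.cons_succ] using hdis j
      · simpa only [Fin.cons_zero, Fin.cons_succ] using (hdis i).symm
      · simp only [Fin.cons_succ, Finset.disjoint_biUnion_left, Finset.disjoint_biUnion_right]
        intro e he f hf
        refine hEd _ _ fun hef => ?_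
        subst hef
        exact Finset.disjoint_left.1 (hBd fun h => hij (congrArg Fin.succ h)) ‹_› ‹_›
    · intro γ
      let γ' : Finset (Fin m) := Finset.univ.filter fun i => i.succ ∈ γ
      have hγ' : ∀ i, i ∈ γ' ↔ i.succ ∈ γ := fun i => by simp [γ']
      have htail : (γ'.biUnion B).biUnion E = γ'.biUnion fun i => (B i).biUnion E :=
        Finset.biUnion_biUnion _ _ _
      refine Fin.cases (fun h0 _ => ?_) fun i hi hmin => ?_
      · rw [Fin.cons_zero, ← hcol (γ'.biUnion B), htail]
        congr 1
        ext a
        simp [Finset.mem_biUnion, Fin.exists_fin_succ, h0, hγ']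
      · rw [Fin.cons_succ, ← hBc γ' i ((hγ' i).2 hi)
          fun j hj => Fin.succ_le_succ_iff.1 (hmin _ ((hγ' j).1 hj))]
        have h0 : (0 : Fin (m + 1)) ∉ γ := fun h0 => by simpa using hmin 0 h0
        rw [htail]
        congr 1
        ext a
        simp [Finset.mem_biUnion, Fin.exists_fin_succ, h0, hγ']

/-- The finite unions theorem. -/
theorem exists_monochromatic_finite_unions (κ : Type) [Finite κ] [Nonempty κ] (s : ℕ) :
    ∃ r : ℕ, ∀ χ : Finset (Fin r) → κ, ∃ B : Finset (Finset (Fin r)),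
      IsDisjointSubcollection s B ∧ ∃ c : κ, ∀ γ : Finset {C // C ∈ B}, γ.Nonempty →
        χ (γ.biUnion fun C => C.1) = c := by
  classical
  have := Fintype.ofFinite κ
  obtain ⟨r, hr⟩ := exists_disjoint_color_eq_of_min κ (Fintype.card κ * s)
  refine ⟨r, fun χ => ?_⟩
  obtain ⟨B, c, hB, hBd, hBc⟩ := hr χ
  -- By pigeonhole, `s` of the sets have the same colour as minimum.
  obtain ⟨y, hy⟩ := Fintype.exists_le_card_fiber_of_mul_le_card c (n := s) (by simp)
  obtain ⟨I, hI, hIs⟩ := Finset.exists_subset_card_eq hy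
  have hinj : Function.Injective B := fun i j hij => by
    by_contra h
    have := hBd h
    simp only [hij, disjoint_self, Finset.bot_eq_empty] at this
    exact (hB j).ne_empty this
  refine ⟨I.image B, ⟨by rw [Finset.card_image_of_injective _ hinj, hIs], ?_, ?_⟩, y, ?_⟩
  · intro C hC
    obtain ⟨i, -, rfl⟩ := Finset.mem_image.1 hC
    exact hB i
  · intro C hC D hD hCD
    obtain ⟨i, -, rfl⟩ := Finset.mem_image.1 (Finset.mem_coe.1 hC)
    obtain ⟨j, -, rfl⟩ := Finset.mem_image.1 (Finset.mem_coe.1 hD)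
    exact hBd fun h => hCD (congrArg B h)
  · intro γ hγ
    let δ : Finset (Fin (Fintype.card κ * s)) :=
      I.filter fun i => ∃ C ∈ γ, B i = C.1
    have hδ : δ.Nonempty := by
      obtain ⟨C, hC⟩ := hγ
      obtain ⟨i, hi, hiC⟩ := Finset.mem_image.1 C.2
      exact ⟨i, Finset.mem_filter.2 ⟨hi, C, hC, hiC⟩⟩
    have hU : (γ.biUnion fun C => C.1) = δ.biUnion B := by
      ext a
      simp only [Finset.mem_biUnion]
      constructor
      · rintro ⟨C, hC, ha⟩
        obtain ⟨i, hi, hiC⟩ := Finset.mem_image.1 C.2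
        exact ⟨i, Finset.mem_filter.2 ⟨hi, C, hC, hiC⟩, hiC ▸ ha⟩
      · rintro ⟨i, hi, ha⟩
        obtain ⟨-, C, hC, hiC⟩ := Finset.mem_filter.1 hi
        exact ⟨C, hC, hiC ▸ ha⟩
    rw [hU, hBc δ (δ.min' hδ) (δ.min'_mem hδ) fun j hj => δ.min'_le j hj]
    have := hI (Finset.mem_of_mem_filter _ (δ.min'_mem hδ))
    simpa using this

end FiniteUnions

end SetPoly

theorem mainTheorem7 (k : ℕ) (d : Fin k → ℕ) (s : ℕ) :
    ∃ r : ℕ, ∀ φ : Fin k → Finset (Fin r) → ℝ,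
      (∀ i, φ i ∈ SetPoly.Pol0 (d i) (Fin r) ℝ) →
      ∃ B : Finset (Finset (Fin r)), SetPoly.IsDisjointSubcollection s B ∧
        ∀ i : Fin k, ∃ ψ ∈ SetPoly.Pol0 (d i) {C // C ∈ B} ℤ, ∃ e : ℤ,
          -(d i : ℤ) ≤ e ∧ e ≤ 0 ∧
          ∀ γ : Finset {C // C ∈ B}, γ.Nonempty →
            ⌊SetPoly.restrict (φ i) B γ⌋ = ψ γ + e := by
  have hN : ∀ i, (0 : ℝ) < 2 ^ (d i + 3) := fun i => by positivity
  have : Nonempty (∀ i, Fin (2 ^ (d i + 3))) := ⟨fun i => ⟨0, by positivity⟩⟩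
  obtain ⟨r, hr⟩ := SetPoly.exists_monochromatic_finite_unions (∀ i, Fin (2 ^ (d i + 3))) s
  refine ⟨r, fun φ hφ => ?_⟩
  obtain ⟨B, hB, c, hc⟩ := hr fun α i => ⟨⌊Int.fract (φ i α) * 2 ^ (d i + 3)⌋₊, by
    rw [Nat.floor_lt (mul_nonneg (Int.fract_nonneg _) (hN i).le)]
    push_cast
    exact mul_lt_of_lt_one_left (hN i) (Int.fract_lt_one _)⟩
  refine ⟨B, hB, fun i => ?_⟩
  refine SetPoly.exists_floor_eq_of_fract_mem (SetPoly.restrict_mem_Pol0 (hφ i) hB.2.2)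
    (L := ((c i : ℕ) : ℝ) / 2 ^ (d i + 3)) (fun γ hγ => ?_) (by positivity) ?_
  · have h : ⌊Int.fract (SetPoly.restrict (φ i) B γ) * 2 ^ (d i + 3)⌋₊ = (c i : ℕ) :=
      congrArg Fin.val (congrFun (hc γ hγ) i)
    obtain ⟨h1, h2⟩ := (Nat.floor_eq_iff (mul_nonneg (Int.fract_nonneg _) (hN i).le)).1 h
    rw [abs_le]
    constructor
    · have : ((c i : ℕ) : ℝ) / 2 ^ (d i + 3) ≤ Int.fract (SetPoly.restrict (φ i) B γ) :=
        (div_le_iff₀ (hN i)).2 h1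
      have : (0 : ℝ) ≤ 1 / 2 ^ (d i + 3) := by positivity
      linarith
    · have h3 := (le_div_iff₀ (hN i)).2 h2.le
      rw [add_div] at h3
      linarith
  · rw [div_lt_one (hN i)]
    exact_mod_cast (c i).2
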